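/- **Setting.** Let $V^+$ be a connected Riemann surface without boundary and $V\subset V^+$ a connected compact $C^\infty$ submanifold with boundary of codimension $0$, with $\partial V\neq\emptyset$. Let $O$ be an interior point of $V$, $z$ a holomorphic local coordinate of $V^+$ centred at $O$, and $\sigma$ an antiholomorphic involution of $V^+$ that preserves $V$ and fixes $O$. A formal-analytic arithmetic surface $\tilde V$ over $\operatorname{Spec}\mathbb Z$, centred at $O$ and with formal part $\operatorname{Spf}\mathbb Z[[T]]$, consists of such data together with a gluing isomorphism from $\operatorname{Spf}\mathbb C[[T]]$ to the formal completion of $V$ at $O$, compatible with $\sigma$ and complex conjugation. In the coordinate $z$ the gluing map is a series $\psi\in\mathbb C[[T]]$ with $\psi(0)=0$, $\psi'(0)\ne0$. Let $\varphi$ be its compositional inverse, a formal function at $O$. For $g\in\mathbb Z[[T]]$ we say that $g\circ\varphi$ *is holomorphic near $V$* if some function holomorphic on an open neighbourhood of $V$ in $V^+$ has Taylor series $g\circ\varphi$ at $O$. Let $g_{V,O}$ be the equilibrium Green's function: the function on $V^+\setminus\{O\}$ that is continuous, vanishes outside the interior $V^\circ$ of $V$, is harmonic on $V^\circ\setminus\{O\}$,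 and differs from $\log|z|^{-1}$ by a bounded function near $O$. Let $c=\lim_{x\to O}\bigl(g_{V,O}(x)-\log|z(x)|^{-1}\bigr)$. The capacitary norm on $T_OV$ is given by $\|\partial/\partial z\|^{\mathrm{cap}}=e^{-c}$, and norms on $(T_OV^\vee)^{\otimes e}$ are induced by duality and tensor power. $\tilde V$ is *pseudoconvex* if the Arakelov degree of the normal bundle $\overline N_P$ of the section $P=\{T=0\}$ of $\operatorname{Spf}\mathbb Z[[T]]$ over $\operatorname{Spec}\mathbb Z$, with the metric induced by the capacitary norm through the gluing map, is negative. A power series $f\in\mathbb Z[[T]]$ is *nonconstant monic* if $f=T^e+\sum_{n>e}a_nT^n$ with $e\ge1$. **Conjecture 1 for $\phi$.** Let $\phi$ be holomorphic on a neighbourhood of $V$ with vanishing order $e$ at $O$. If $\log\|\phi^{[e]}(O)\|^{\mathrm{cap},\otimes e}_{V,O}<0$, where $\phi^{[e]}(O)=\frac{\phi^{(e)}(O)}{e!}(dz)^{\otimes e}$ is the $e$-th jet in the coordinate $z$, and if $\phi\circ\tau=\overline\phi$ near $V$ for some antiholomorphic involution $\tau$ of $V^+$ preserving $V$ and fixing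 $O$, then there is a monic $p\in\mathbb R[X]$ with $\inf_{x\in V}|p(1/\phi(x))|>1$, where the infimum is over the $x\in V$ with $\phi(x)\neq0$ (the value at a zero of $\phi$ being read as $+\infty$). **Theorem 1.1.** Let $\tilde V$ be a pseudoconvex formal-analytic arithmetic surface over $\operatorname{Spec}\mathbb Z$ as above, and let $\varphi$ be the compositional inverse of its gluing map. Suppose there is a nonconstant monic $f\in\mathbb Z[[T]]$ such that $\phi=f\circ\varphi$ is holomorphic near $V$, and that Conjecture 1 holds for $\phi$. Then the set of $g\in\mathbb Z[[T]]$ such that $g\circ\varphi$ is holomorphic near $V$ has the cardinality of the continuum. -/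

import Mathlib

open scoped Manifold ContDiff PowerSeries Topology ComplexConjugate

noncomputable section

namespace FormalAnalytic

section RiemannSurfaces

variable {M : Type*} [TopologicalSpace M] [ChartedSpace ℂ M]

/-- `V` is a connected compact smooth domain with nonempty boundary in the Riemann surface `M`
(`M` plays the role of `V⁺`): near each boundary point, `V` is the sublevel set `{ρ ≤ 0}` of a
`C^∞` real function `ρ` whose differential does not vanish at that point, which says that `V` is a
`C^∞` submanifold with boundary, of codimension `0`, of `M`. -/
structure IsBorderedSurface (V : Set M) : Prop where
  isCompact : IsCompact V
  isConnected : IsConnected V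
  frontier_nonempty : (frontier V).Nonempty
  smooth_boundary : ∀ p ∈ frontier V, ∃ ρ : M → ℝ,
    ContDiffAt ℝ ∞ (ρ ∘ (chartAt ℂ p).symm) (chartAt ℂ p p) ∧
    fderiv ℝ (ρ ∘ (chartAt ℂ p).symm) (chartAt ℂ p p) ≠ 0 ∧
    ∀ᶠ q in 𝓝 p, (q ∈ V ↔ ρ q ≤ 0)

/-- `F` is holomorphic on some open neighbourhood of `V`. -/
def HolomorphicNear (V : Set M) (F : M → ℂ) : Prop :=
  ∃ U : Set M, IsOpen U ∧ V ⊆ U ∧ MDifferentiableOn 𝓘(ℂ) 𝓘(ℂ) F U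

/-- `σ : M → M` is antiholomorphic: it is continuous, and its expression in charts is the complex
conjugate of a holomorphic function. -/
def Antiholomorphic (σ : M → M) : Prop :=
  Continuous σ ∧ ∀ x : M, DifferentiableAt ℂ
    (fun w : ℂ => conj (chartAt ℂ (σ x) (σ ((chartAt ℂ x).symm w)))) (chartAt ℂ x x)

/-- `σ` is an antiholomorphic involution of `M` which preserves `V` and for which `O` is a real
point. -/
structure IsRealStructure (V : Set M) (O : M) (σ : M → M) : Prop where
  antiholomorphic : Antiholomorphic σ
  involutive : Function.Involutive σ
  mapsTo : Set.MapsTo σ V V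
  fixes : σ O = O

/-- `z` is a holomorphic local coordinate of `M` centred at `O`. -/
structure IsLocalCoordinate (O : M) (z : OpenPartialHomeomorph M ℂ) : Prop where
  mem_atlas : z ∈ IsManifold.maximalAtlas 𝓘(ℂ) ω M
  mem_source : O ∈ z.source
  map_zero : z O = 0

/-- The Taylor series at `O`, in the local coordinate `z` centred at `O`, of a function `F` which is
holomorphic near `O`: the image of `F` in the completed local ring at `O`, identified with
`ℂ⟦X⟧` by means of `z`. -/
def taylor (z : OpenPartialHomeomorph M ℂ) (F : M → ℂ) : ℂ⟦X⟧ :=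
  PowerSeries.mk fun n => iteratedDeriv n (F ∘ z.symm) 0 / (n.factorial : ℂ)

/-- The defining properties of the equilibrium Green's function of `V` at `O`. The value at `O`
is irrelevant. -/
structure IsEquilibriumGreen (V : Set M) (O : M) (g : M → ℝ) : Prop where
  continuousOn : ContinuousOn g {O}ᶜ
  vanishes : ∀ x ∉ interior V, g x = 0
  harmonic : ∀ x ∈ interior V, x ≠ O →
    InnerProductSpace.HarmonicAt (g ∘ (chartAt ℂ x).symm) (chartAt ℂ x x)
  log_singularity : ∃ C : ℝ, ∀ᶠ x in 𝓝[≠] O,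
    |g x - Real.log (‖chartAt ℂ O x - chartAt ℂ O O‖⁻¹)| ≤ C

open Classical in
/-- The equilibrium Green's function of `V` at `O`. For a bordered Riemann surface `V` with `O` in
its interior, a function with the defining properties exists and is unique away from `O`. -/
def equilibriumGreen (V : Set M) (O : M) : M → ℝ :=
  if h : ∃ g : M → ℝ, IsEquilibriumGreen V O g then h.choose else 0

/-- The capacity `e^{-c}` of `V` at `O` in the coordinate `z`, where `c` is the limit at `O` of
`g_{V,O} - log |z|⁻¹`. -/
def capacity (V : Set M) (O : M) (z : OpenPartialHomeomorph M ℂ) : ℝ :=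
  Real.exp (-Filter.limUnder (𝓝[≠] O) fun w => equilibriumGreen V O w - Real.log (‖z w‖⁻¹))

/-- The capacitary norm of the tangent vector `a · ∂/∂z` at `O`; thus `∂/∂z` has norm
`capacity V O z`. -/
def capTangentNorm (V : Set M) (O : M) (z : OpenPartialHomeomorph M ℂ) (a : ℂ) : ℝ :=
  ‖a‖ * capacity V O z

/-- The capacitary norm of the `e`-th jet at `O` of a function `F` vanishing to order `e` at `O`.
This jet is `a · (dz)^{⊗ e}` with `a = F^{(e)}(O) / e!`, and `dz` has the norm dual to that of
`∂/∂z`. -/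
def capJetNorm (V : Set M) (O : M) (z : OpenPartialHomeomorph M ℂ) (e : ℕ) (F : M → ℂ) : ℝ :=
  ‖PowerSeries.coeff e (taylor z F)‖ * ((capTangentNorm V O z 1)⁻¹) ^ e

/-- The instance, for the function `F`, of the conjecture: if `F` is holomorphic near `V` and
vanishes to order `e` at `O`, if its `e`-th jet at `O` has capacitary norm with negative logarithm,
and if `F ∘ σ` is the conjugate of `F` (near `V`) for an antiholomorphic involution `σ`, then
there is a monic real polynomial `p` with `inf_{x ∈ V} |p (1 / F x)| > 1`. At the zeros of `F`,
where `1 / F` has a pole, `|p (1 / F)|` is read as infinite. -/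
def ConjectureHoldsFor (V : Set M) (O : M) (z : OpenPartialHomeomorph M ℂ) (F : M → ℂ) : Prop :=
  ∀ (e : ℕ) (σ : M → M),
    HolomorphicNear V F →
    (taylor z F).order = e →
    IsRealStructure V O σ →
    Real.log (capJetNorm V O z e F) < 0 →
    (∀ᶠ x in 𝓝ˢ V, F (σ x) = conj (F x)) →
    ∃ p : Polynomial ℝ, p.Monic ∧ ∃ c : ℝ, 1 < c ∧
      ∀ x ∈ V, F x ≠ 0 → c ≤ ‖Polynomial.aeval (1 / F x) p‖

end RiemannSurfaces

section ArithmeticSurfaces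

/-- A formal-analytic arithmetic surface over `Spec ℤ` with underlying formal scheme `Spf ℤ⟦T⟧`
and with Riemann surface `V ⊆ V⁺ = M`.

The gluing isomorphism from `Spf ℂ⟦T⟧` to the formal completion of `V` at `O` is given by the
pull-back of the local coordinate `z`, which is the power series `glue` (`ψ`). It is defined over
`ℝ`: the pull-back of `conj (z ∘ σ)` is the coefficientwise conjugate of the pull-back of `z`. -/
structure Surface (M : Type*) [TopologicalSpace M] [ChartedSpace ℂ M] where
  V : Set M
  O : M
  σ : M → M
  z : OpenPartialHomeomorph M ℂ
  glue : ℂ⟦X⟧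
  bordered : IsBorderedSurface V
  O_mem : O ∈ interior V
  real : IsRealStructure V O σ
  coord : IsLocalCoordinate O z
  glue_zero : PowerSeries.constantCoeff glue = 0
  glue_deriv : PowerSeries.coeff 1 glue ≠ 0
  glue_real : PowerSeries.subst glue (taylor z fun x => conj (z (σ x))) =
    PowerSeries.map (starRingEnd ℂ) glue

/-- `φ` is the compositional inverse of `ψ`. -/
structure IsCompositionalInverse (ψ φ : ℂ⟦X⟧) : Prop where
  zero : PowerSeries.constantCoeff φ = 0
  left : PowerSeries.subst ψ φ = PowerSeries.X
  right : PowerSeries.subst φ ψ = PowerSeries.X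

/-- A power series `T^e + (higher order terms)` with integer coefficients and `e ≥ 1`. -/
def IsNonconstantMonic (f : ℤ⟦X⟧) : Prop :=
  ∃ e : ℕ, 1 ≤ e ∧ (∀ n < e, PowerSeries.coeff n f = 0) ∧ PowerSeries.coeff e f = 1

/-- The ideal of the canonical section `P : Spec ℤ → Spf ℤ⟦T⟧`. -/
abbrev sectionIdeal : Ideal ℤ⟦X⟧ := Ideal.span {PowerSeries.X}

/-- The class of `T` in the conormal module `I / I²`. -/
def conormalT : sectionIdeal.Cotangent :=
  sectionIdeal.toCotangent ⟨PowerSeries.X, Ideal.mem_span_singleton_self _⟩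

/-- The normal bundle of `P` in `Spf ℤ⟦T⟧`: the `ℤ`-dual of `I / I²`. -/
abbrev NormalBundle : Type := Module.Dual ℤ sectionIdeal.Cotangent

open Classical in
/-- The Arakelov degree of a Hermitian line bundle over `Spec ℤ`, given by a free `ℤ`-module `L` of
rank one and a norm: `-log ‖s‖` for either of the two generators `s` of `L`. -/
def arakelovDegree (L : Type*) [AddCommGroup L] (norm : L → ℝ) : ℝ :=
  if h : ∃ s : L, ∀ v : L, ∃ n : ℤ, v = n • s then -Real.log (norm h.choose) else 0

variable {M : Type*} [TopologicalSpace M] [ChartedSpace ℂ M]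

namespace Surface

/-- The capacitary metric on the normal bundle of `P`: by the differential of the gluing map, the
normal vector `v = v(T) · ∂/∂T` has image `v(T) ψ'(0) · ∂/∂z` in the tangent line of `V` at `O`. -/
def normalNorm (S : Surface M) (v : NormalBundle) : ℝ :=
  capTangentNorm S.V S.O S.z ((v conormalT : ℂ) * PowerSeries.coeff 1 S.glue)

/-- The Arakelov degree of the normal bundle with its capacitary metric is negative. -/
def Pseudoconvex (S : Surface M) : Prop :=
  arakelovDegree NormalBundle S.normalNorm < 0

/-- The function `F : M → ℂ` is holomorphic near `V`, and its germ at `O` is the formal function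
`g ∘ φ`, where `φ` is a formal function at `O` written in the coordinate `z`. -/
def Represents (S : Surface M) (φ : ℂ⟦X⟧) (g : ℤ⟦X⟧) (F : M → ℂ) : Prop :=
  HolomorphicNear S.V F ∧ taylor S.z F = PowerSeries.subst φ g

end Surface

end ArithmeticSurfaces

end FormalAnalytic

end

/-!
Let `ϕ` be the function with Taylor series `f ∘ φ`. Pseudoconvexity says `‖ψ'(0)‖ · cap > 1`. Since
`f` is monic of order `e`, the `e`-th jet of `ϕ` has coefficient `φ'(0) ^ e = ψ'(0) ^ (-e)`, so its
capacitary norm is less than `1`. Moreover `ϕ` is real: by the reality of the gluing map, `ϕ` and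
`conj (ϕ ∘ σ)` have the same Taylor series at `O`, and the identity theorem on the connected set `V`
propagates the equality (`Surface.Represents.eventually_apply_involution`). So the conjecture
applies to `ϕ`, and gives a monic real polynomial `p`, of degree `d` say, with `|p (1 / ϕ)| > 1` on
`V`. In terms of the reverse polynomial `q` of `p`, which has constant term `1`, this says that `ϕ`
maps `V` into the open set `|w ^ d / q w| < 1` of the plane (`lemniscate`, `mem_lemniscate_reverse`).

It remains to find continuum many functions which are holomorphic on this plane set and have an
integral Maclaurin series; composing them with `ϕ` proves the theorem, since the Taylor series of
`H ∘ ϕ` is the substitution of `f ∘ φ` into that of `H` (`maclaurin_comp`). With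
`h = w ^ d / q w`, every series `∑ b_{dk+j} w ^ j h ^ k`, over `k` and `j < d`, with bounded real
coefficients converges to a holomorphic function where `|h| < 1`. Its `m`-th term, `m = dk + j`, is
`b_m (w ^ m + ⋯)`. So the `b_m` can be chosen one after the other to make the Maclaurin coefficients
integers, by rounding up, and each `b_m` can be kept in `[0, 2)` with two choices left at every step
(`roundingCoeff`, `exists_injective_integral_maclaurin`). Different sequences of choices give
different series.
-/

namespace FormalAnalytic

/-! ### Maclaurin series of holomorphic functions -/

/-- The formal Maclaurin series of `F : ℂ → ℂ`, so that `taylor z F` is the Maclaurin series of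
`F ∘ z.symm`. -/
noncomputable def maclaurin (F : ℂ → ℂ) : ℂ⟦X⟧ :=
  PowerSeries.mk fun n => iteratedDeriv n F 0 / (n.factorial : ℂ)

lemma coeff_maclaurin (F : ℂ → ℂ) (n : ℕ) :
    PowerSeries.coeff n (maclaurin F) = iteratedDeriv n F 0 / (n.factorial : ℂ) :=
  PowerSeries.coeff_mk _ _

lemma constantCoeff_maclaurin (F : ℂ → ℂ) :
    PowerSeries.constantCoeff (maclaurin F) = F 0 := by
  rw [← PowerSeries.coeff_zero_eq_constantCoeff_apply, coeff_maclaurin]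
  simp

lemma maclaurin_congr {F G : ℂ → ℂ} (h : F =ᶠ[𝓝 0] G) : maclaurin F = maclaurin G := by
  ext n
  rw [coeff_maclaurin, coeff_maclaurin, h.iteratedDeriv_eq n]

lemma maclaurin_add {F G : ℂ → ℂ} (hF : AnalyticAt ℂ F 0) (hG : AnalyticAt ℂ G 0) :
    maclaurin (F + G) = maclaurin F + maclaurin G := by
  ext n
  rw [map_add, coeff_maclaurin, coeff_maclaurin, coeff_maclaurin,
    iteratedDeriv_add hF.contDiffAt hG.contDiffAt, add_div]

lemma maclaurin_mul {F G : ℂ → ℂ} (hF : AnalyticAt ℂ F 0) (hG : AnalyticAt ℂ G 0) :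
    maclaurin (F * G) = maclaurin F * maclaurin G := by
  ext n
  rw [PowerSeries.coeff_mul, coeff_maclaurin,
    iteratedDeriv_mul hF.contDiffAt hG.contDiffAt,
    Finset.Nat.sum_antidiagonal_eq_sum_range_succ
      (fun i j => PowerSeries.coeff i (maclaurin F) * PowerSeries.coeff j (maclaurin G)),
    Finset.sum_div]
  refine Finset.sum_congr rfl fun i hi => ?_
  have hi' : i ≤ n := Nat.lt_succ_iff.mp (Finset.mem_range.mp hi)
  have h := Nat.choose_mul_factorial_mul_factorial hi'
  have h' : (n.choose i : ℂ) * i.factorial * (n - i).factorial = n.factorial := by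
    exact_mod_cast h
  have h1 : (i.factorial : ℂ) ≠ 0 := by exact_mod_cast i.factorial_ne_zero
  have h2 : ((n - i).factorial : ℂ) ≠ 0 := by exact_mod_cast (n - i).factorial_ne_zero
  have h3 : (n.factorial : ℂ) ≠ 0 := by exact_mod_cast n.factorial_ne_zero
  rw [coeff_maclaurin, coeff_maclaurin]
  field_simp
  rw [← h']
  ring

lemma maclaurin_const (c : ℂ) : maclaurin (fun _ => c) = PowerSeries.C c := by
  ext n
  rw [coeff_maclaurin, iteratedDeriv_const, PowerSeries.coeff_C]
  split_ifs with h <;> simp [h]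

lemma maclaurin_id : maclaurin id = PowerSeries.X := by
  ext n
  rw [coeff_maclaurin, iteratedDeriv_id, PowerSeries.coeff_X]
  rcases n with _ | _ | n <;> simp

lemma maclaurin_pow {F : ℂ → ℂ} (hF : AnalyticAt ℂ F 0) (k : ℕ) :
    maclaurin (F ^ k) = maclaurin F ^ k := by
  induction k with
  | zero => exact (maclaurin_const 1).trans (map_one _)
  | succ k ih => rw [pow_succ, pow_succ, maclaurin_mul (hF.pow k) hF, ih]

lemma maclaurin_sum {ι : Type*} (s : Finset ι) {F : ι → ℂ → ℂ}
    (hF : ∀ i ∈ s, AnalyticAt ℂ (F i) 0) :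
    maclaurin (∑ i ∈ s, F i) = ∑ i ∈ s, maclaurin (F i) := by
  classical
  induction s using Finset.induction_on with
  | empty => exact (maclaurin_const 0).trans (map_zero _)
  | insert a s ha ih =>
    rw [Finset.sum_insert ha, Finset.sum_insert ha, maclaurin_add (hF a (by simp))
      (Finset.analyticAt_sum _ fun i hi => hF i (by simp [hi])),
      ih fun i hi => hF i (by simp [hi])]

lemma maclaurin_aeval (q : Polynomial ℝ) :
    maclaurin (fun w => Polynomial.aeval w q) =
      PowerSeries.map (algebraMap ℝ ℂ) (q : ℝ⟦X⟧) := by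
  have han : ∀ q : Polynomial ℝ, AnalyticAt ℂ (fun w : ℂ => Polynomial.aeval w q) 0 :=
    fun q => AnalyticAt.aeval_polynomial analyticAt_id q
  induction q using Polynomial.induction_on' with
  | add p q hp hq =>
    have : (fun w : ℂ => Polynomial.aeval w (p + q)) =
        (fun w => Polynomial.aeval w p) + fun w => Polynomial.aeval w q := by
      ext w; simp
    rw [this, maclaurin_add (han p) (han q), hp, hq, Polynomial.coe_add, map_add]
  | monomial n a =>
    have : (fun w : ℂ => Polynomial.aeval w (Polynomial.monomial n a)) =
        (fun _ => (a : ℂ)) * (id : ℂ → ℂ) ^ n := by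
      ext w; simp [Polynomial.aeval_monomial]
    rw [this, maclaurin_mul analyticAt_const (analyticAt_id.pow n), maclaurin_const,
      maclaurin_pow analyticAt_id, maclaurin_id, Polynomial.coe_monomial,
      PowerSeries.monomial_eq_C_mul_X_pow, map_mul]
    simp

lemma eventuallyEq_of_maclaurin_eq {F G : ℂ → ℂ} (hF : AnalyticAt ℂ F 0)
    (hG : AnalyticAt ℂ G 0) (h : maclaurin F = maclaurin G) : F =ᶠ[𝓝 0] G := by
  have hc : (fun n => iteratedDeriv n F 0 / (n.factorial : ℂ)) =
      fun n => iteratedDeriv n G 0 / (n.factorial : ℂ) := by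
    ext n
    rw [← coeff_maclaurin, h, coeff_maclaurin]
  have h1 := hF.hasFPowerSeriesAt
  rw [hc] at h1
  have h2 := h1.sub hG.hasFPowerSeriesAt
  rw [sub_self] at h2
  filter_upwards [h2.eventually_eq_zero] with w hw
  exact sub_eq_zero.mp hw

lemma maclaurin_conj (F : ℂ → ℂ) :
    maclaurin (conj ∘ F ∘ conj) = PowerSeries.map (starRingEnd ℂ) (maclaurin F) := by
  have h : ∀ n (F : ℂ → ℂ), iteratedDeriv n (conj ∘ F ∘ conj) = conj ∘ iteratedDeriv n F ∘ conj := by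
    intro n
    induction n with
    | zero => intro F; simp
    | succ n ih => intro F; rw [iteratedDeriv_succ', deriv_conj_conj, ih, iteratedDeriv_succ']
  ext n
  rw [PowerSeries.coeff_map, coeff_maclaurin, coeff_maclaurin, h]
  simp

/-- The Maclaurin series of a composition is the composition of the Maclaurin series. Writing
`F w = F 0 + w · F₁ w` with `F₁` analytic, the difference of the two sides for `F` is `maclaurin a`
times the difference for `F₁`, so it is divisible by every power of `X`. -/
lemma maclaurin_comp {F a : ℂ → ℂ} (hF : AnalyticAt ℂ F 0) (ha : AnalyticAt ℂ a 0)
    (ha0 : a 0 = 0) :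
    maclaurin (F ∘ a) = PowerSeries.subst (maclaurin a) (maclaurin F) := by
  have hs : PowerSeries.HasSubst (maclaurin a) :=
    PowerSeries.HasSubst.of_constantCoeff_zero' (by rw [constantCoeff_maclaurin, ha0])
  have hX : PowerSeries.X ∣ maclaurin a := by
    rw [PowerSeries.X_dvd_iff, constantCoeff_maclaurin, ha0]
  have key : ∀ (N : ℕ) (F : ℂ → ℂ), AnalyticAt ℂ F 0 →
      PowerSeries.X ^ N ∣
        maclaurin (F ∘ a) - PowerSeries.subst (maclaurin a) (maclaurin F) := by
    intro N
    induction N with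
    | zero => intro F _; simp
    | succ N ih =>
      intro F hF
      obtain ⟨p, hp⟩ := hF
      set F₁ := dslope F 0
      have hF₁ : AnalyticAt ℂ F₁ 0 := ⟨_, hp.has_fpower_series_dslope_fslope⟩
      have hdec : F = (fun _ => F 0) + id * F₁ := by
        ext w
        have := sub_smul_dslope F 0 w
        simp only [sub_zero, smul_eq_mul] at this
        simp [F₁, this]
      have hF₁a : AnalyticAt ℂ (F₁ ∘ a) 0 := by
        refine AnalyticAt.comp ?_ ha
        rwa [ha0]
      have hcomp : F ∘ a = (fun _ => F 0) + a * (F₁ ∘ a) := by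
        conv_lhs => rw [hdec]
        rfl
      have h1 : maclaurin (F ∘ a) =
          PowerSeries.C (F 0) + maclaurin a * maclaurin (F₁ ∘ a) := by
        rw [hcomp, maclaurin_add analyticAt_const (ha.mul hF₁a), maclaurin_mul ha hF₁a,
          maclaurin_const]
      have h2 : maclaurin F = PowerSeries.C (F 0) + PowerSeries.X * maclaurin F₁ := by
        conv_lhs => rw [hdec]
        rw [maclaurin_add analyticAt_const (analyticAt_id.mul hF₁),
          maclaurin_mul analyticAt_id hF₁, maclaurin_const, maclaurin_id]
      have h3 : PowerSeries.subst (maclaurin a) (PowerSeries.C (F 0) : ℂ⟦X⟧) =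
          PowerSeries.C (F 0) := PowerSeries.subst_C _
      rw [h1, h2, PowerSeries.subst_add hs, PowerSeries.subst_mul hs, PowerSeries.subst_X hs, h3,
        add_sub_add_left_eq_sub, ← mul_sub, pow_succ']
      exact mul_dvd_mul hX (ih F₁ hF₁)
  ext n
  have := PowerSeries.X_pow_dvd_iff.mp (key (n + 1) F hF) n n.lt_succ_self
  rwa [map_sub, sub_eq_zero] at this

/-! ### Substitution of formal power series -/

lemma subst_map_algebraMap {R : Type*} [CommRing R] [Algebra R ℂ] {a : ℂ⟦X⟧}
    (ha : PowerSeries.HasSubst a) (f : R⟦X⟧) :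
    PowerSeries.subst a (PowerSeries.map (algebraMap R ℂ) f) = PowerSeries.subst a f := by
  ext n
  rw [PowerSeries.coeff_subst' ha, PowerSeries.coeff_subst' ha]
  simp [Algebra.smul_def]

/-- If `f` vanishes to order at least `n`, then `f ∘ a` is divisible by `a ^ n`, and the quotient has
the `n`-th coefficient of `f` as its constant term. -/
lemma subst_eq_pow_mul {R S : Type*} [CommRing R] [CommRing S] [Algebra R S] {a : S⟦X⟧}
    (ha : PowerSeries.constantCoeff a = 0) {f : R⟦X⟧} {n : ℕ}
    (hf : ∀ m < n, PowerSeries.coeff m f = 0) :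
    ∃ u : S⟦X⟧, PowerSeries.subst a f = a ^ n * u ∧
      PowerSeries.constantCoeff u = algebraMap R S (PowerSeries.coeff n f) := by
  have hs : PowerSeries.HasSubst a := PowerSeries.HasSubst.of_constantCoeff_zero' ha
  obtain ⟨g, rfl⟩ := PowerSeries.X_pow_dvd_iff.mpr hf
  refine ⟨PowerSeries.subst a g, ?_, ?_⟩
  · rw [PowerSeries.subst_mul hs, PowerSeries.subst_pow hs, PowerSeries.subst_X hs]
  · have hg : g = PowerSeries.C (PowerSeries.constantCoeff g) +
        PowerSeries.X * PowerSeries.mk fun p => PowerSeries.coeff (p + 1) g := by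
      rw [add_comm]; exact PowerSeries.eq_X_mul_shift_add_const g
    have h0 : PowerSeries.coeff n (PowerSeries.X ^ n * g) = PowerSeries.constantCoeff g := by
      simpa using PowerSeries.coeff_X_pow_mul g n 0
    rw [h0, ← PowerSeries.coeff_zero_eq_constantCoeff_apply, PowerSeries.coeff_subst' hs,
      finsum_eq_single _ 0]
    · simp [Algebra.smul_def]
    · intro m hm
      simp [ha, hm]

lemma subst_injective {f : ℤ⟦X⟧} (hf0 : PowerSeries.constantCoeff f = 0) (hf : f ≠ 0) :
    Function.Injective fun G : ℤ⟦X⟧ => PowerSeries.subst f G := by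
  have hs : PowerSeries.HasSubst f := PowerSeries.HasSubst.of_constantCoeff_zero' hf0
  intro G₁ G₂ h
  by_contra hne
  have hD : G₁ - G₂ ≠ 0 := sub_ne_zero.mpr hne
  have hD0 : PowerSeries.subst f (G₁ - G₂) = 0 := by
    rw [PowerSeries.subst_sub hs]; exact sub_eq_zero.mpr h
  obtain ⟨u, hu, hu0⟩ := subst_eq_pow_mul (n := (G₁ - G₂).order.toNat) hf0
    (fun m hm => PowerSeries.coeff_of_lt_order_toNat m hm)
  rw [hD0] at hu
  rcases mul_eq_zero.mp hu.symm with h1 | h1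
  · exact hf (eq_zero_of_pow_eq_zero h1)
  · rw [h1, map_zero] at hu0
    exact PowerSeries.coeff_order hD (by simpa using hu0.symm)

/-! ### Rounding a triangular family of real power series to integer coefficients -/

/-- Coefficients `b₀, b₁, …`, chosen one after the other, such that the series `∑ bₘ eₘ` is integral
when `eₘ` is a real power series `X ^ m + ⋯` with `n`-th coefficient `E m n`. The `n`-th
coefficient of that series is the least integer above the contribution of the terms with `m < n`,
or its successor, according to `ε n`. -/
noncomputable def roundingCoeff (E : ℕ → ℕ → ℝ) (ε : ℕ → Bool) (n : ℕ) : ℝ :=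
  (⌈∑ m : Fin n, roundingCoeff E ε m * E m n⌉ : ℝ) + (if ε n then 1 else 0) -
    ∑ m : Fin n, roundingCoeff E ε m * E m n
termination_by n
decreasing_by all_goals exact m.2

/-- The integral power series `∑ bₘ eₘ` attached to the coefficients `roundingCoeff E ε`. -/
noncomputable def roundedSeries (E : ℕ → ℕ → ℝ) (ε : ℕ → Bool) : ℤ⟦X⟧ :=
  PowerSeries.mk fun n =>
    ⌈∑ m ∈ Finset.range n, roundingCoeff E ε m * E m n⌉ + (if ε n then 1 else 0)

lemma roundingCoeff_eq (E : ℕ → ℕ → ℝ) (ε : ℕ → Bool) (n : ℕ) :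
    roundingCoeff E ε n = (⌈∑ m ∈ Finset.range n, roundingCoeff E ε m * E m n⌉ : ℝ) +
      (if ε n then 1 else 0) - ∑ m ∈ Finset.range n, roundingCoeff E ε m * E m n := by
  rw [roundingCoeff, Fin.sum_univ_eq_sum_range (fun m => roundingCoeff E ε m * E m n)]

lemma abs_roundingCoeff_le (E : ℕ → ℕ → ℝ) (ε : ℕ → Bool) (n : ℕ) :
    |roundingCoeff E ε n| ≤ 2 := by
  rw [roundingCoeff_eq]
  set s := ∑ m ∈ Finset.range n, roundingCoeff E ε m * E m n
  have h1 := Int.le_ceil s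
  have h2 := Int.ceil_lt_add_one s
  rw [abs_le]
  split_ifs <;> constructor <;> linarith

lemma coeff_roundedSeries (E : ℕ → ℕ → ℝ) (ε : ℕ → Bool) (n : ℕ) :
    ((PowerSeries.coeff n (roundedSeries E ε) : ℤ) : ℝ) =
      ∑ m ∈ Finset.range n, roundingCoeff E ε m * E m n + roundingCoeff E ε n := by
  rw [roundingCoeff_eq E ε n, roundedSeries, PowerSeries.coeff_mk]
  push_cast
  ring

lemma roundedSeries_injective (E : ℕ → ℕ → ℝ) : Function.Injective (roundedSeries E) := by
  intro ε ε' h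
  have hb : ∀ n, roundingCoeff E ε n = roundingCoeff E ε' n := by
    intro n
    induction n using Nat.strong_induction_on with
    | _ n ih =>
      have h1 := coeff_roundedSeries E ε n
      rw [h, coeff_roundedSeries, Finset.sum_congr rfl fun m hm =>
        by rw [← ih m (Finset.mem_range.mp hm)]] at h1
      linarith
  ext n
  have h1 := congrArg (PowerSeries.coeff n) h
  simp only [roundedSeries, PowerSeries.coeff_mk, hb] at h1
  have h2 := add_left_cancel h1
  cases hε : ε n <;> cases hε' : ε' n <;> simp [hε, hε'] at h2 ⊢

lemma X_pow_dvd_roundedSeries_sub (e : ℕ → ℝ⟦X⟧) (he : ∀ m, ∀ n < m, PowerSeries.coeff n (e m) = 0)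
    (he1 : ∀ m, PowerSeries.coeff m (e m) = 1) (ε : ℕ → Bool) (N : ℕ) :
    PowerSeries.X ^ N ∣
      PowerSeries.map (algebraMap ℤ ℝ)
          (roundedSeries (fun m n => PowerSeries.coeff n (e m)) ε) -
        ∑ m ∈ Finset.range N,
          PowerSeries.C (roundingCoeff (fun m n => PowerSeries.coeff n (e m)) ε m) * e m := by
  rw [PowerSeries.X_pow_dvd_iff]
  intro n hn
  rw [map_sub, PowerSeries.coeff_map, sub_eq_zero, map_sum]
  simp only [PowerSeries.coeff_C_mul]
  rw [← Finset.sum_subset (Finset.range_subset_range.mpr (Nat.succ_le_of_lt hn)),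
    Finset.sum_range_succ, he1, mul_one]
  · exact coeff_roundedSeries _ ε n
  · intro m _ hm
    rw [he m n (by simpa using hm), mul_zero]

/-! ### Holomorphic functions with integral Maclaurin series -/

/-- The open set of `w ∈ ℂ` where `w ^ d / q w` has modulus less than `1`. -/
noncomputable def lemniscate (q : Polynomial ℝ) (d : ℕ) : Set ℂ :=
  {w | ‖w ^ d‖ < ‖Polynomial.aeval w q‖}

/-- The function `w ^ d / q w`. Its junk value `0` at the zeros of `q` does not matter: they lie outside
`lemniscate q d`. -/
noncomputable def lemniscateMap (q : Polynomial ℝ) (d : ℕ) (w : ℂ) : ℂ :=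
  w ^ d / Polynomial.aeval w q

/-- The block `∑_{j < d} b_{dk+j} w ^ j` of degree less than `d`. -/
noncomputable def block (d : ℕ) (b : ℕ → ℝ) (k : ℕ) (w : ℂ) : ℂ :=
  ∑ j ∈ Finset.range d, (b (d * k + j) : ℂ) * w ^ j

/-- The series `∑ b_{dk+j} w ^ j h ^ k` over `k` and `j < d`, with `h = w ^ d / q w`. -/
noncomputable def lemniscateSeries (q : Polynomial ℝ) (d : ℕ) (b : ℕ → ℝ) (w : ℂ) : ℂ :=
  ∑' k, block d b k w * lemniscateMap q d w ^ k

variable {q : Polynomial ℝ} {d : ℕ} {b : ℕ → ℝ} {C : ℝ}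

lemma differentiable_aeval (q : Polynomial ℝ) :
    Differentiable ℂ fun w : ℂ => Polynomial.aeval w q := by
  have : (fun w : ℂ => Polynomial.aeval w q) =
      fun w => (q.map (algebraMap ℝ ℂ)).eval w := by
    ext w; simp [Polynomial.aeval_def, Polynomial.eval_map]
  rw [this]
  exact Polynomial.differentiable _

lemma differentiable_block (d : ℕ) (b : ℕ → ℝ) (k : ℕ) : Differentiable ℂ (block d b k) := by
  unfold block
  fun_prop

lemma isOpen_lemniscate (q : Polynomial ℝ) (d : ℕ) : IsOpen (lemniscate q d) :=
  isOpen_lt (by fun_prop) (differentiable_aeval q).continuous.norm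

lemma zero_mem_lemniscate (hq : q.coeff 0 = 1) (hd : 1 ≤ d) : (0 : ℂ) ∈ lemniscate q d := by
  have hd' : d ≠ 0 := by lia
  simp [lemniscate, hd', ← Polynomial.coeff_zero_eq_aeval_zero', hq]

lemma aeval_ne_zero_of_mem_lemniscate {w : ℂ} (hw : w ∈ lemniscate q d) :
    Polynomial.aeval w q ≠ 0 :=
  norm_pos_iff.mp ((norm_nonneg _).trans_lt hw)

lemma norm_lemniscateMap_lt_one {w : ℂ} (hw : w ∈ lemniscate q d) :
    ‖lemniscateMap q d w‖ < 1 := by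
  rw [lemniscateMap, norm_div, div_lt_one (norm_pos_iff.mpr (aeval_ne_zero_of_mem_lemniscate hw))]
  exact hw

lemma differentiableOn_lemniscateMap (q : Polynomial ℝ) (d : ℕ) :
    DifferentiableOn ℂ (lemniscateMap q d) (lemniscate q d) :=
  DifferentiableOn.div (by fun_prop) (differentiable_aeval q).differentiableOn
    fun _ hw => aeval_ne_zero_of_mem_lemniscate hw

lemma norm_block_le (hb : ∀ n, |b n| ≤ C) {w : ℂ} {R : ℝ} (hw : ‖w‖ ≤ R) (k : ℕ) :
    ‖block d b k w‖ ≤ ∑ j ∈ Finset.range d, C * R ^ j := by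
  refine (norm_sum_le _ _).trans (Finset.sum_le_sum fun j _ => ?_)
  rw [norm_mul, norm_pow, Complex.norm_real, Real.norm_eq_abs]
  exact mul_le_mul (hb _) (pow_le_pow_left₀ (norm_nonneg _) hw j) (by positivity)
    ((abs_nonneg _).trans (hb 0))

lemma summable_lemniscateSeries (hb : ∀ n, |b n| ≤ C) {w : ℂ} (hw : w ∈ lemniscate q d) :
    Summable fun k => block d b k w * lemniscateMap q d w ^ k := by
  refine Summable.of_norm_bounded ((summable_geometric_of_lt_one (norm_nonneg _)
    (norm_lemniscateMap_lt_one hw)).mul_left (∑ j ∈ Finset.range d, C * ‖w‖ ^ j)) fun k => ?_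
  rw [norm_mul, norm_pow]
  exact mul_le_mul_of_nonneg_right (norm_block_le hb le_rfl k) (by positivity)

lemma differentiableOn_lemniscateSeries (hb : ∀ n, |b n| ≤ C) :
    DifferentiableOn ℂ (lemniscateSeries q d b) (lemniscate q d) := by
  intro w₀ hw₀
  obtain ⟨r, hr, hr1⟩ := exists_between (norm_lemniscateMap_lt_one hw₀)
  have hr0 : 0 ≤ r := (norm_nonneg _).trans hr.le
  set W : Set ℂ := (lemniscate q d ∩ lemniscateMap q d ⁻¹' Metric.ball 0 r) ∩
    Metric.ball 0 (‖w₀‖ + 1)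
  have hW : IsOpen W := ((differentiableOn_lemniscateMap q d).continuousOn.isOpen_inter_preimage
    (isOpen_lemniscate q d) Metric.isOpen_ball).inter Metric.isOpen_ball
  have hw₀W : w₀ ∈ W := ⟨⟨hw₀, by simpa using hr⟩, by simp⟩
  have hdiff : DifferentiableOn ℂ (lemniscateSeries q d b) W := by
    refine Complex.differentiableOn_tsum_of_summable_norm
      (u := fun k => (∑ j ∈ Finset.range d, C * (‖w₀‖ + 1) ^ j) * r ^ k)
      ((summable_geometric_of_lt_one hr0 hr1).mul_left _) (fun k => ?_) hW fun k w hw => ?_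
    · exact (differentiable_block d b k).differentiableOn.mul
        (((differentiableOn_lemniscateMap q d).mono fun w hw => hw.1.1).pow k)
    · have h1 : ‖lemniscateMap q d w‖ ≤ r := by
        have := hw.1.2
        simp only [Set.mem_preimage, mem_ball_zero_iff] at this
        exact this.le
      have h2 : ‖w‖ ≤ ‖w₀‖ + 1 := (mem_ball_zero_iff.mp hw.2).le
      rw [norm_mul, norm_pow]
      have h3 := norm_block_le (d := d) hb h2 k
      exact mul_le_mul h3 (pow_le_pow_left₀ (norm_nonneg _) h1 k) (by positivity)
        ((norm_nonneg _).trans h3)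
  exact (hdiff.differentiableAt (hW.mem_nhds hw₀W)).differentiableWithinAt

/-- Splitting off the first block leaves `h` times the series with shifted coefficients; iterating this
compares the Maclaurin series of the sum with the partial sums of blocks. -/
lemma lemniscateSeries_eq_add_mul (hb : ∀ n, |b n| ≤ C) {w : ℂ} (hw : w ∈ lemniscate q d) :
    lemniscateSeries q d b w =
      block d b 0 w + lemniscateMap q d w * lemniscateSeries q d (fun n => b (d + n)) w := by
  have hs := summable_lemniscateSeries hb hw
  rw [lemniscateSeries, hs.tsum_eq_zero_add, lemniscateSeries, ← tsum_mul_left]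
  congr 1
  · simp
  · refine tsum_congr fun k => ?_
    have : block d b (k + 1) w = block d (fun n => b (d + n)) k w := by
      refine Finset.sum_congr rfl fun j _ => ?_
      rw [show d * (k + 1) + j = d + (d * k + j) by ring]
    rw [this, pow_succ]
    ring

lemma maclaurin_block (d : ℕ) (b : ℕ → ℝ) (k : ℕ) :
    maclaurin (block d b k) =
      ∑ j ∈ Finset.range d, PowerSeries.C (b (d * k + j) : ℂ) * PowerSeries.X ^ j := by
  have : block d b k =
      ∑ j ∈ Finset.range d, (fun _ => (b (d * k + j) : ℂ)) * (id : ℂ → ℂ) ^ j := by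
    ext w; simp [block]
  rw [this, maclaurin_sum _ fun j _ => analyticAt_const.mul (analyticAt_id.pow j)]
  refine Finset.sum_congr rfl fun j _ => ?_
  rw [maclaurin_mul analyticAt_const (analyticAt_id.pow j), maclaurin_const,
    maclaurin_pow analyticAt_id, maclaurin_id]

lemma analyticAt_lemniscateMap (hq : q.coeff 0 = 1) (hd : 1 ≤ d) :
    AnalyticAt ℂ (lemniscateMap q d) 0 :=
  (differentiableOn_lemniscateMap q d).analyticAt
    ((isOpen_lemniscate q d).mem_nhds (zero_mem_lemniscate hq hd))

lemma pow_dvd_maclaurin_lemniscateSeries_sub (hq : q.coeff 0 = 1) (hd : 1 ≤ d)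
    (hb : ∀ n, |b n| ≤ C) (K : ℕ) :
    maclaurin (lemniscateMap q d) ^ K ∣ maclaurin (lemniscateSeries q d b) -
      ∑ k ∈ Finset.range K, maclaurin (block d b k) * maclaurin (lemniscateMap q d) ^ k := by
  induction K generalizing b with
  | zero => simp
  | succ K ih =>
    have hnhds : lemniscate q d ∈ 𝓝 (0 : ℂ) :=
      (isOpen_lemniscate q d).mem_nhds (zero_mem_lemniscate hq hd)
    have hb' : ∀ n, |b (d + n)| ≤ C := fun n => hb _
    have han : AnalyticAt ℂ (lemniscateSeries q d fun n => b (d + n)) 0 :=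
      (differentiableOn_lemniscateSeries hb').analyticAt hnhds
    have hblock : AnalyticAt ℂ (block d b 0) 0 := (differentiable_block d b 0).analyticAt 0
    have hmap := analyticAt_lemniscateMap hq hd
    have h : lemniscateSeries q d b =ᶠ[𝓝 0]
        block d b 0 + lemniscateMap q d * lemniscateSeries q d fun n => b (d + n) := by
      filter_upwards [hnhds] with w hw
      exact lemniscateSeries_eq_add_mul hb hw
    have hshift : ∀ k, maclaurin (block d b (k + 1)) =
        maclaurin (block d (fun n => b (d + n)) k) := by
      intro k
      rw [maclaurin_block, maclaurin_block]
      refine Finset.sum_congr rfl fun j _ => ?_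
      rw [show d * (k + 1) + j = d + (d * k + j) by ring]
    rw [maclaurin_congr h, maclaurin_add hblock (hmap.mul han), maclaurin_mul hmap han,
      Finset.sum_range_succ', pow_zero, mul_one, add_comm (∑ k ∈ Finset.range K, _),
      add_sub_add_left_eq_sub]
    have hsum : ∑ k ∈ Finset.range K,
        maclaurin (block d b (k + 1)) * maclaurin (lemniscateMap q d) ^ (k + 1) =
        maclaurin (lemniscateMap q d) * ∑ k ∈ Finset.range K,
          maclaurin (block d (fun n => b (d + n)) k) * maclaurin (lemniscateMap q d) ^ k := by
      rw [Finset.mul_sum]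
      refine Finset.sum_congr rfl fun k _ => ?_
      rw [hshift, pow_succ]
      ring
    rw [hsum, ← mul_sub, pow_succ']
    exact mul_dvd_mul_left _ (ih hb')

/-- The Maclaurin series `X ^ d / q` of `w ^ d / q w`, over the reals. -/
noncomputable def lemniscateMapSeries (q : Polynomial ℝ) (d : ℕ) : ℝ⟦X⟧ :=
  PowerSeries.X ^ d * (q : ℝ⟦X⟧)⁻¹

lemma maclaurin_lemniscateMap (hq : q.coeff 0 = 1) (hd : 1 ≤ d) :
    maclaurin (lemniscateMap q d) =
      PowerSeries.map (algebraMap ℝ ℂ) (lemniscateMapSeries q d) := by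
  have hc : PowerSeries.constantCoeff (q : ℝ⟦X⟧) = 1 := by simpa using hq
  have hQ : PowerSeries.map (algebraMap ℝ ℂ) (q : ℝ⟦X⟧) ≠ 0 := by
    intro h
    have := congrArg PowerSeries.constantCoeff h
    rw [← PowerSeries.coeff_zero_eq_constantCoeff_apply, PowerSeries.coeff_map,
      PowerSeries.coeff_zero_eq_constantCoeff_apply, hc] at this
    simp at this
  refine mul_right_cancel₀ hQ ?_
  rw [← map_mul, lemniscateMapSeries, mul_assoc, PowerSeries.inv_mul_cancel _ (by rw [hc]; simp),
    mul_one, ← maclaurin_aeval, ← maclaurin_mul (analyticAt_lemniscateMap hq hd)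
      ((differentiable_aeval q).analyticAt 0), map_pow, PowerSeries.map_X, ← maclaurin_id,
    ← maclaurin_pow analyticAt_id]
  refine maclaurin_congr ?_
  filter_upwards [(isOpen_lemniscate q d).mem_nhds (zero_mem_lemniscate hq hd)] with w hw
  exact div_mul_cancel₀ _ (aeval_ne_zero_of_mem_lemniscate hw)

/-- The real power series `X ^ j * (X ^ d / q) ^ k = X ^ m + ⋯`, where `m = dk + j` with `j < d`. -/
noncomputable def lemniscateBasis (q : Polynomial ℝ) (d m : ℕ) : ℝ⟦X⟧ :=
  PowerSeries.X ^ (m % d) * lemniscateMapSeries q d ^ (m / d)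

lemma lemniscateBasis_eq (q : Polynomial ℝ) (d m : ℕ) :
    lemniscateBasis q d m = PowerSeries.X ^ m * (q : ℝ⟦X⟧)⁻¹ ^ (m / d) := by
  rw [lemniscateBasis, lemniscateMapSeries, mul_pow, ← mul_assoc, ← pow_mul, ← pow_add,
    Nat.mod_add_div]

lemma coeff_lemniscateBasis_of_lt {m n : ℕ} (h : n < m) :
    PowerSeries.coeff n (lemniscateBasis q d m) = 0 :=
  PowerSeries.X_pow_dvd_iff.mp ⟨_, lemniscateBasis_eq q d m⟩ n h

lemma coeff_lemniscateBasis_self (hq : q.coeff 0 = 1) (m : ℕ) :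
    PowerSeries.coeff m (lemniscateBasis q d m) = 1 := by
  have hc : PowerSeries.constantCoeff (q : ℝ⟦X⟧) = 1 := by simpa using hq
  have := PowerSeries.coeff_X_pow_mul ((q : ℝ⟦X⟧)⁻¹ ^ (m / d)) m 0
  rw [zero_add] at this
  rw [lemniscateBasis_eq, this, PowerSeries.coeff_zero_eq_constantCoeff_apply, map_pow,
    PowerSeries.constantCoeff_inv, hc, inv_one, one_pow]

/-- The first `dK` terms of the formal series are the Maclaurin series of the first `K` blocks. -/
lemma sum_lemniscateBasis (hq : q.coeff 0 = 1) (hd : 1 ≤ d) (b : ℕ → ℝ) (K : ℕ) :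
    PowerSeries.map (algebraMap ℝ ℂ)
        (∑ m ∈ Finset.range (d * K), PowerSeries.C (b m) * lemniscateBasis q d m) =
      ∑ k ∈ Finset.range K, maclaurin (block d b k) * maclaurin (lemniscateMap q d) ^ k := by
  induction K with
  | zero => simp
  | succ K ih =>
    rw [mul_add, mul_one, Finset.sum_range_add, map_add, ih, Finset.sum_range_succ, maclaurin_block,
      Finset.sum_mul, map_sum]
    congr 1
    refine Finset.sum_congr rfl fun j hj => ?_
    have hj' := Finset.mem_range.mp hj
    rw [lemniscateBasis, Nat.mul_add_mod, Nat.mod_eq_of_lt hj', Nat.mul_add_div (by lia),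
      Nat.div_eq_of_lt hj', add_zero, maclaurin_lemniscateMap hq hd]
    simp only [map_mul, map_pow, PowerSeries.map_C, PowerSeries.map_X, mul_assoc]
    rfl

/-- There are as many integral power series which are the Maclaurin series of a function holomorphic
on `lemniscate q d` as there are sequences of binary choices. -/
theorem exists_injective_integral_maclaurin (hq : q.coeff 0 = 1) (hd : 1 ≤ d) :
    ∃ G : (ℕ → Bool) → ℤ⟦X⟧, Function.Injective G ∧ ∀ ε, ∃ F : ℂ → ℂ,
      DifferentiableOn ℂ F (lemniscate q d) ∧
        maclaurin F = PowerSeries.map (algebraMap ℤ ℂ) (G ε) := by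
  let E : ℕ → ℕ → ℝ := fun m n => PowerSeries.coeff n (lemniscateBasis q d m)
  refine ⟨roundedSeries E, roundedSeries_injective E, fun ε => ?_⟩
  have hb := abs_roundingCoeff_le E ε
  refine ⟨lemniscateSeries q d (roundingCoeff E ε), differentiableOn_lemniscateSeries hb, ?_⟩
  ext n
  have hX : (PowerSeries.X : ℂ⟦X⟧) ∣ maclaurin (lemniscateMap q d) := by
    rw [PowerSeries.X_dvd_iff, constantCoeff_maclaurin, lemniscateMap, zero_pow (by lia), zero_div]
  have h1 := (pow_dvd_pow_of_dvd hX (n + 1)).trans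
    (pow_dvd_maclaurin_lemniscateSeries_sub hq hd hb (n + 1))
  have h2 := map_dvd (PowerSeries.map (algebraMap ℝ ℂ))
    (X_pow_dvd_roundedSeries_sub (lemniscateBasis q d) (fun _ _ => coeff_lemniscateBasis_of_lt)
      (coeff_lemniscateBasis_self hq) ε (d * (n + 1)))
  rw [map_pow, PowerSeries.map_X, map_sub, sum_lemniscateBasis hq hd] at h2
  have h3 := PowerSeries.X_pow_dvd_iff.mp h1 n n.lt_succ_self
  have h4 := PowerSeries.X_pow_dvd_iff.mp h2 n (by nlinarith)
  rw [map_sub, sub_eq_zero] at h3 h4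
  rw [h3, ← h4]
  simp [E]

/-! ### Holomorphic functions on a Riemann surface -/

section Holomorphic

variable {M : Type*} [TopologicalSpace M] [ChartedSpace ℂ M]

/-- Precomposition with an antiholomorphic map, followed by complex conjugation, preserves
holomorphy. -/
lemma Antiholomorphic.mdifferentiableAt_conj_comp {σ : M → M} (hσ : Antiholomorphic σ)
    {F : M → ℂ} {x : M} (hF : MDifferentiableAt 𝓘(ℂ) 𝓘(ℂ) F (σ x)) :
    MDifferentiableAt 𝓘(ℂ) 𝓘(ℂ) (fun y => conj (F (σ y))) x := by
  rw [mdifferentiableAt_iff] at hF ⊢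
  refine ⟨Complex.continuous_conj.continuousAt.comp
    (ContinuousAt.comp (f := σ) hF.1 hσ.1.continuousAt), ?_⟩
  have h1 : DifferentiableAt ℂ (F ∘ (chartAt ℂ (σ x)).symm) (chartAt ℂ (σ x) (σ x)) := by
    have := hF.2
    rwa [modelWithCornersSelf_coe, Set.range_id, differentiableWithinAt_univ] at this
  have h2 := h1.conj_conj
  have h3 : DifferentiableAt ℂ
      ((conj ∘ (F ∘ (chartAt ℂ (σ x)).symm) ∘ conj) ∘
        fun w : ℂ => conj (chartAt ℂ (σ x) (σ ((chartAt ℂ x).symm w)))) (chartAt ℂ x x) := by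
    refine DifferentiableAt.comp _ ?_ (hσ.2 x)
    rwa [(chartAt ℂ x).left_inv (mem_chart_source ℂ x)]
  suffices h : DifferentiableAt ℂ ((fun y => conj (F (σ y))) ∘ (chartAt ℂ x).symm)
      (chartAt ℂ x x) by
    rwa [modelWithCornersSelf_coe, Set.range_id, differentiableWithinAt_univ]
  refine h3.congr_of_eventuallyEq ?_
  have hcont : ContinuousAt (fun w => σ ((chartAt ℂ x).symm w)) (chartAt ℂ x x) :=
    hσ.1.continuousAt.comp ((chartAt ℂ x).continuousAt_symm (mem_chart_target ℂ x))
  have hmem : (chartAt ℂ (σ x)).source ∈ 𝓝 (σ ((chartAt ℂ x).symm (chartAt ℂ x x))) := by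
    rw [(chartAt ℂ x).left_inv (mem_chart_source ℂ x)]
    exact chart_source_mem_nhds ℂ (σ x)
  filter_upwards [hcont.preimage_mem_nhds hmem] with w hw
  simp [(chartAt ℂ (σ x)).left_inv hw]

lemma IsLocalCoordinate.symm_zero {O : M} {z : OpenPartialHomeomorph M ℂ}
    (hz : IsLocalCoordinate O z) : z.symm 0 = O := by
  rw [← hz.map_zero, z.left_inv hz.mem_source]

lemma analyticAt_comp_symm {z : OpenPartialHomeomorph M ℂ}
    (hz : z ∈ IsManifold.maximalAtlas 𝓘(ℂ) ω M) {F : M → ℂ} {U : Set M} (hU : IsOpen U)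
    (hF : MDifferentiableOn 𝓘(ℂ) 𝓘(ℂ) F U) {x : M} (hx : x ∈ z.source) (hxU : x ∈ U) :
    AnalyticAt ℂ (F ∘ z.symm) (z x) := by
  have h1 : MDifferentiableOn 𝓘(ℂ) 𝓘(ℂ) (F ∘ z.symm) (z.target ∩ z.symm ⁻¹' U) :=
    hF.comp (((contMDiffOn_symm_of_mem_maximalAtlas hz).mdifferentiableOn (by simp)).mono
      Set.inter_subset_left) fun w hw => hw.2
  refine (mdifferentiableOn_iff_differentiableOn.mp h1).analyticAt
    ((z.isOpen_inter_preimage_symm hU).mem_nhds ⟨z.map_source hx, ?_⟩)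
  simpa [z.left_inv hx] using hxU

/-- A holomorphic function is determined near `O` by its Taylor series in the coordinate `z`. -/
lemma eventuallyEq_of_taylor_eq {O : M} {z : OpenPartialHomeomorph M ℂ}
    (hz : IsLocalCoordinate O z) {U : Set M} (hU : IsOpen U) (hO : O ∈ U) {F G : M → ℂ}
    (hF : MDifferentiableOn 𝓘(ℂ) 𝓘(ℂ) F U) (hG : MDifferentiableOn 𝓘(ℂ) 𝓘(ℂ) G U)
    (h : taylor z F = taylor z G) : F =ᶠ[𝓝 O] G := by
  have h1 := analyticAt_comp_symm hz.mem_atlas hU hF hz.mem_source hO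
  have h2 := analyticAt_comp_symm hz.mem_atlas hU hG hz.mem_source hO
  have hz0 := hz.map_zero
  rw [hz0] at h1 h2
  have h3 := eventuallyEq_of_maclaurin_eq h1 h2 h
  have hcont := z.continuousAt hz.mem_source
  rw [ContinuousAt, hz0] at hcont
  filter_upwards [hcont.eventually h3, z.open_source.mem_nhds hz.mem_source] with y hy hyc
  simpa [z.left_inv hyc] using hy

lemma taylor_comp {O : M} {z : OpenPartialHomeomorph M ℂ} (hz : IsLocalCoordinate O z)
    {U : Set M} (hU : IsOpen U) (hO : O ∈ U) {F : M → ℂ} (hF : MDifferentiableOn 𝓘(ℂ) 𝓘(ℂ) F U)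
    (hF0 : F O = 0) {H : ℂ → ℂ} (hH : AnalyticAt ℂ H 0) :
    taylor z (fun x => H (F x)) = PowerSeries.subst (taylor z F) (maclaurin H) := by
  have h1 := analyticAt_comp_symm hz.mem_atlas hU hF hz.mem_source hO
  rw [hz.map_zero] at h1
  exact maclaurin_comp hH h1 (by simp [hz.symm_zero, hF0])

/-- In the coordinate `z`, the function `conj (F ∘ σ)` is the composition of the coefficientwise
conjugate of `F` with `conj (z ∘ σ)`. -/
lemma taylor_conj_comp {V : Set M} {O : M} {z : OpenPartialHomeomorph M ℂ} {σ : M → M}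
    (hz : IsLocalCoordinate O z) (hσ : IsRealStructure V O σ) {U : Set M} (hU : IsOpen U)
    (hO : O ∈ U) {F : M → ℂ} (hF : MDifferentiableOn 𝓘(ℂ) 𝓘(ℂ) F U) :
    taylor z (fun x => conj (F (σ x))) =
      PowerSeries.subst (taylor z fun x => conj (z (σ x)))
        (PowerSeries.map (starRingEnd ℂ) (taylor z F)) := by
  have hFz := analyticAt_comp_symm hz.mem_atlas hU hF hz.mem_source hO
  rw [hz.map_zero] at hFz
  have hFbar : AnalyticAt ℂ (conj ∘ (F ∘ z.symm) ∘ conj) 0 := by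
    have hev : ∀ᶠ w in 𝓝 (0 : ℂ), AnalyticAt ℂ (F ∘ z.symm) w := hFz.eventually_analyticAt
    have hc : Filter.Tendsto (conj : ℂ → ℂ) (𝓝 0) (𝓝 0) := by
      simpa using Complex.continuous_conj.tendsto 0
    rw [Complex.analyticAt_iff_eventually_differentiableAt]
    filter_upwards [hc.eventually hev] with w hw
    simpa using hw.differentiableAt.conj_conj
  have hσc : Continuous σ := hσ.antiholomorphic.1
  have hzσ : MDifferentiableOn 𝓘(ℂ) 𝓘(ℂ) (fun x => conj (z (σ x))) (σ ⁻¹' z.source) := by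
    intro x hx
    refine (hσ.antiholomorphic.mdifferentiableAt_conj_comp ?_).mdifferentiableWithinAt
    exact ((contMDiffOn_of_mem_maximalAtlas hz.mem_atlas).mdifferentiableOn
      (by simp)).mdifferentiableAt (z.open_source.mem_nhds hx)
  have hOσ : O ∈ σ ⁻¹' z.source := by
    rw [Set.mem_preimage, hσ.fixes]; exact hz.mem_source
  have hopen := z.open_source.preimage hσc
  have h := taylor_comp hz hopen hOσ hzσ (by rw [hσ.fixes, hz.map_zero, map_zero]) hFbar
  rw [maclaurin_conj] at h
  refine Eq.trans (maclaurin_congr ?_) h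
  have hsymm : ContinuousAt z.symm 0 := by
    rw [← hz.map_zero]; exact z.continuousAt_symm (z.map_source hz.mem_source)
  have hmem : σ ⁻¹' z.source ∈ 𝓝 (z.symm 0) := by
    rw [hz.symm_zero]; exact hopen.mem_nhds hOσ
  filter_upwards [hsymm.preimage_mem_nhds hmem] with w hw
  have : z.symm (z (σ (z.symm w))) = σ (z.symm w) := z.left_inv hw
  simp [this]

variable [IsManifold 𝓘(ℂ) ω M]

/-- The identity theorem on a connected set `V`. -/
lemma eventually_nhdsSet_eq_of_eventuallyEq {V U : Set M} (hV : IsPreconnected V) (hU : IsOpen U)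
    (hVU : V ⊆ U) {F G : M → ℂ} (hF : MDifferentiableOn 𝓘(ℂ) 𝓘(ℂ) F U)
    (hG : MDifferentiableOn 𝓘(ℂ) 𝓘(ℂ) G U) {O : M} (hO : O ∈ V) (h : F =ᶠ[𝓝 O] G) :
    ∀ᶠ x in 𝓝ˢ V, F x = G x := by
  have hopen : IsOpen {x | F =ᶠ[𝓝 x] G} := isOpen_setOfPred_eventually_nhds
  have hsub : V ⊆ {x | F =ᶠ[𝓝 x] G} := by
    refine hV.subset_of_closure_inter_subset hopen ⟨O, hO, h⟩ ?_
    rintro x ⟨hx, hxV⟩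
    by_contra hne
    set c := chartAt ℂ x
    have hc : c ∈ IsManifold.maximalAtlas 𝓘(ℂ) ω M := IsManifold.chart_mem_maximalAtlas x
    have hxc : x ∈ c.source := mem_chart_source ℂ x
    have h1 := analyticAt_comp_symm hc hU hF hxc (hVU hxV)
    have h2 := analyticAt_comp_symm hc hU hG hxc (hVU hxV)
    have h3 : ∃ᶠ y in 𝓝[≠] x, F y = G y := by
      have h4 : ∃ᶠ y in 𝓝 x, F =ᶠ[𝓝 y] G := mem_closure_iff_frequently.mp hx
      rw [frequently_nhdsWithin_iff]
      refine h4.mono fun y hy => ⟨hy.self_of_nhds, ?_⟩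
      rintro rfl
      exact hne hy
    have h5 : ∃ᶠ w in 𝓝[≠] (c x), (F ∘ c.symm) w = (G ∘ c.symm) w := by
      intro hcon
      refine h3 ?_
      have htend : Filter.Tendsto c (𝓝[≠] x) (𝓝[≠] (c x)) := by
        refine tendsto_nhdsWithin_of_tendsto_nhds_of_eventually_within _
          ((c.continuousAt hxc).tendsto.mono_left nhdsWithin_le_nhds) ?_
        filter_upwards [self_mem_nhdsWithin,
          nhdsWithin_le_nhds (c.open_source.mem_nhds hxc)] with y hy hyc hxy
        exact hy (c.injOn hyc hxc hxy)
      filter_upwards [htend.eventually hcon,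
        nhdsWithin_le_nhds (c.open_source.mem_nhds hxc)] with y hy hyc
      simpa [c.left_inv hyc] using hy
    have h6 := (h1.frequently_eq_iff_eventually_eq h2).mp h5
    refine hne ?_
    filter_upwards [(c.continuousAt hxc).eventually h6, c.open_source.mem_nhds hxc] with y hy hyc
    simpa [c.left_inv hyc] using hy
  filter_upwards [hopen.mem_nhdsSet.mpr hsub] with x hx
  exact hx.self_of_nhds

end Holomorphic

/-! ### Consequences of the arithmetic hypotheses -/

/-- Taking the coefficient of `T` is a well-defined linear form on `I / I²`, since it vanishes on
products of elements of `I`. -/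
lemma exists_normalBundle_apply_conormalT_eq_one : ∃ v : NormalBundle, v conormalT = 1 := by
  have hf : ∀ x ∈ sectionIdeal, PowerSeries.constantCoeff x = 0 := fun x hx =>
    PowerSeries.X_dvd_iff.mp (Ideal.mem_span_singleton.mp hx)
  let l : sectionIdeal →+ ℤ :=
    (PowerSeries.coeff (R := ℤ) 1).toAddMonoidHom.comp sectionIdeal.toAddSubgroup.subtype
  have hl : ∀ x ∈ (sectionIdeal • (⊤ : Submodule ℤ⟦X⟧ sectionIdeal)).toAddSubgroup, l x = 0 := by
    intro x hx
    refine Submodule.smul_induction_on (p := fun x => l x = 0) hx (fun r hr y _ => ?_)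
      fun x y hx hy => by rw [map_add, hx, hy, add_zero]
    obtain ⟨u, rfl⟩ := PowerSeries.X_dvd_iff.mpr (hf r hr)
    change PowerSeries.coeff (0 + 1) (PowerSeries.X * u * (y : ℤ⟦X⟧)) = 0
    rw [mul_assoc, PowerSeries.coeff_succ_X_mul]
    simp [hf y y.2]
  let L : sectionIdeal.Cotangent →+ ℤ := QuotientAddGroup.lift _ l hl
  refine ⟨L.toIntLinearMap, ?_⟩
  change PowerSeries.coeff 1 (PowerSeries.X : ℤ⟦X⟧) = 1
  exact PowerSeries.coeff_one_X

section Surface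

variable {M : Type*} [TopologicalSpace M] [ChartedSpace ℂ M]

lemma capacity_pos (V : Set M) (O : M) (z : OpenPartialHomeomorph M ℂ) : 0 < capacity V O z :=
  Real.exp_pos _

/-- The Arakelov degree of the normal bundle is `-log (‖ψ'(0)‖ · cap)`, because a generator of the
normal bundle takes the value `1` or `-1` at the class of `T`. -/
lemma Surface.Pseudoconvex.one_lt {S : Surface M} (hS : S.Pseudoconvex) :
    1 < ‖PowerSeries.coeff 1 S.glue‖ * capacity S.V S.O S.z := by
  classical
  unfold Surface.Pseudoconvex arakelovDegree at hS
  split_ifs at hS with h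
  · obtain ⟨v, hv⟩ := exists_normalBundle_apply_conormalT_eq_one
    obtain ⟨n, hn⟩ := h.choose_spec v
    have hunit : IsUnit (h.choose conormalT) := by
      refine IsUnit.of_mul_eq_one n ?_
      rw [← hv, hn]
      simp [mul_comm]
    have habs : ‖((h.choose conormalT : ℤ) : ℂ)‖ = 1 := by
      rcases Int.isUnit_iff.mp hunit with h1 | h1 <;> simp [h1]
    rw [Surface.normalNorm, capTangentNorm, norm_mul, habs, one_mul, neg_lt_zero] at hS
    exact (Real.log_pos_iff (mul_nonneg (norm_nonneg _) (capacity_pos _ _ _).le)).mp hS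
  · exact absurd hS (lt_irrefl _)

lemma IsCompositionalInverse.coeff_one_mul {ψ φ : ℂ⟦X⟧} (h : IsCompositionalInverse ψ φ)
    (hψ : PowerSeries.constantCoeff ψ = 0) :
    PowerSeries.coeff 1 φ * PowerSeries.coeff 1 ψ = 1 := by
  obtain ⟨u, hu, hu0⟩ := subst_eq_pow_mul (n := 1) hψ (f := φ) (fun m hm => by
    rw [Nat.lt_one_iff.mp hm, PowerSeries.coeff_zero_eq_constantCoeff_apply, h.zero])
  rw [h.left, pow_one] at hu
  have h1 := congrArg (PowerSeries.coeff 1) hu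
  rw [PowerSeries.coeff_one_X, PowerSeries.coeff_mul, Finset.Nat.antidiagonal_succ] at h1
  simp [hψ, hu0] at h1
  rw [mul_comm, h1]

/-- The formal function `φ` is real: if `τ` is the expansion of `conj (z ∘ σ)` in the coordinate `z`,
then the conjugate of `φ ∘ σ`, which is the composition of the conjugate series of `φ` with `τ`, is
`φ`. -/
lemma IsCompositionalInverse.subst_map_conj {ψ φ τ : ℂ⟦X⟧} (h : IsCompositionalInverse ψ φ)
    (hψ : PowerSeries.constantCoeff ψ = 0) (hτ : PowerSeries.constantCoeff τ = 0)
    (hψτ : PowerSeries.subst ψ τ = PowerSeries.map (starRingEnd ℂ) ψ) :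
    PowerSeries.subst τ (PowerSeries.map (starRingEnd ℂ) φ) = φ := by
  have sφ := PowerSeries.HasSubst.of_constantCoeff_zero' h.zero
  have sψ := PowerSeries.HasSubst.of_constantCoeff_zero' hψ
  have sτ := PowerSeries.HasSubst.of_constantCoeff_zero' hτ
  have h1 : PowerSeries.subst ψ (PowerSeries.subst τ (PowerSeries.map (starRingEnd ℂ) φ)) =
      PowerSeries.X := by
    rw [PowerSeries.subst_comp_subst_apply sτ sψ, hψτ]
    have := PowerSeries.map_subst sψ (h := starRingEnd ℂ) φ
    rw [h.left] at this
    exact this.symm.trans (PowerSeries.map_X _)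
  have h2 := congrArg (PowerSeries.subst φ) h1
  rwa [PowerSeries.subst_comp_subst_apply sψ sφ, h.right, PowerSeries.subst_X sφ,
    PowerSeries.X_subst] at h2

end Surface

/-! ### Composition with the given function -/

variable {M : Type*} [TopologicalSpace M] [ChartedSpace ℂ M]

/-- If `f = T ^ e + ⋯`, then `f ∘ φ` has leading term `φ'(0) ^ e z ^ e`. -/
lemma coeff_subst_of_monic {φ : ℂ⟦X⟧} (hφ : PowerSeries.constantCoeff φ = 0) {f : ℤ⟦X⟧} {e : ℕ}
    (hf : ∀ n < e, PowerSeries.coeff n f = 0) (hf1 : PowerSeries.coeff e f = 1) :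
    (∀ n < e, PowerSeries.coeff n (PowerSeries.subst φ f : ℂ⟦X⟧) = 0) ∧
      PowerSeries.coeff e (PowerSeries.subst φ f : ℂ⟦X⟧) = PowerSeries.coeff 1 φ ^ e := by
  obtain ⟨u, hu, hu0⟩ := subst_eq_pow_mul (S := ℂ) hφ hf
  obtain ⟨φ₁, rfl⟩ := PowerSeries.X_dvd_iff.mpr hφ
  rw [mul_pow, mul_assoc] at hu
  have h1 : PowerSeries.coeff 1 (PowerSeries.X * φ₁) = PowerSeries.constantCoeff φ₁ := by
    simp
  have h2 := PowerSeries.coeff_X_pow_mul (φ₁ ^ e * u) e 0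
  refine ⟨PowerSeries.X_pow_dvd_iff.mp ⟨_, hu⟩, ?_⟩
  rw [zero_add] at h2
  rw [hu, h2, h1, PowerSeries.coeff_zero_eq_constantCoeff_apply, map_mul, hu0, hf1, map_pow]
  simp

/-- A function near `V` with Taylor series `f ∘ φ`, for `f` with integer coefficients, commutes with
the real structure: both `φ` and `f` are real. -/
lemma Surface.Represents.eventually_apply_involution [IsManifold 𝓘(ℂ) ω M] {S : Surface M}
    {φ : ℂ⟦X⟧} (hφ : IsCompositionalInverse S.glue φ) {f : ℤ⟦X⟧} {F : M → ℂ}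
    (hF : S.Represents φ f F) : ∀ᶠ x in 𝓝ˢ S.V, F (S.σ x) = conj (F x) := by
  obtain ⟨⟨U, hU, hVU, hFU⟩, hT⟩ := hF
  have hOV : S.O ∈ S.V := interior_subset S.O_mem
  have hσc : Continuous S.σ := S.real.antiholomorphic.1
  have hU' : IsOpen (U ∩ S.σ ⁻¹' U) := hU.inter (hU.preimage hσc)
  have hVU' : S.V ⊆ U ∩ S.σ ⁻¹' U := fun x hx => ⟨hVU hx, hVU (S.real.mapsTo hx)⟩
  have hFbar : MDifferentiableOn 𝓘(ℂ) 𝓘(ℂ) (fun x => conj (F (S.σ x))) (U ∩ S.σ ⁻¹' U) :=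
    fun x hx => (S.real.antiholomorphic.mdifferentiableAt_conj_comp
      (hFU.mdifferentiableAt (hU.mem_nhds hx.2))).mdifferentiableWithinAt
  have hF' := hFU.mono (Set.inter_subset_left (t := S.σ ⁻¹' U))
  set τ := taylor S.z fun x => conj (S.z (S.σ x)) with hτdef
  have hτ : PowerSeries.constantCoeff τ = 0 := by
    refine (constantCoeff_maclaurin _).trans ?_
    simp [S.coord.symm_zero, S.real.fixes, S.coord.map_zero]
  have sφ := PowerSeries.HasSubst.of_constantCoeff_zero' hφ.zero
  have sτ := PowerSeries.HasSubst.of_constantCoeff_zero' hτ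
  have sφbar : PowerSeries.HasSubst (PowerSeries.map (starRingEnd ℂ) φ) :=
    PowerSeries.HasSubst.of_constantCoeff_zero' (by
      rw [← PowerSeries.coeff_zero_eq_constantCoeff_apply, PowerSeries.coeff_map,
        PowerSeries.coeff_zero_eq_constantCoeff_apply, hφ.zero, map_zero])
  have hmap : PowerSeries.map (starRingEnd ℂ) (PowerSeries.subst φ f : ℂ⟦X⟧) =
      PowerSeries.subst (PowerSeries.map (starRingEnd ℂ) φ) f := by
    rw [← subst_map_algebraMap sφ]
    refine (PowerSeries.map_subst sφ (h := starRingEnd ℂ) _).trans ?_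
    rw [← subst_map_algebraMap sφbar]
    congr 1
    ext n
    simp
  have hTbar : taylor S.z (fun x => conj (F (S.σ x))) = taylor S.z F := by
    rw [taylor_conj_comp S.coord S.real hU (hVU hOV) hFU, hT, hmap,
      PowerSeries.subst_comp_subst_apply sφbar sτ,
      hφ.subst_map_conj S.glue_zero hτ S.glue_real]
  have hnear := eventuallyEq_of_taylor_eq S.coord hU' (hVU' hOV) hFbar hF' hTbar
  filter_upwards [eventually_nhdsSet_eq_of_eventuallyEq S.bordered.isConnected.isPreconnected hU'
    hVU' hFbar hF' hOV hnear] with x hx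
  rw [← hx, Complex.conj_conj]

/-- If `|p (1 / w)| > 1`, then `w` lies in the lemniscate of the reverse polynomial of `p`. -/
lemma mem_lemniscate_reverse {p : Polynomial ℝ} {w : ℂ} (hw : w ≠ 0)
    (h : 1 < ‖Polynomial.aeval (1 / w) p‖) : w ∈ lemniscate p.reverse p.natDegree := by
  have hinv : Invertible (1 / w) := invertibleOfNonzero (one_div_ne_zero hw)
  have hrev := Polynomial.eval₂_reverse_mul_pow (algebraMap ℝ ℂ) (1 / w) p
  rw [invOf_eq_inv, one_div, inv_inv, inv_pow] at hrev
  rw [Polynomial.aeval_def, one_div, ← hrev, norm_mul, norm_inv, ← div_eq_mul_inv,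
    one_lt_div (norm_pos_iff.mpr (pow_ne_zero _ hw))] at h
  exact h

/-- If `H` has the integral Maclaurin series `G` and is holomorphic on a neighbourhood of `F (V)`, where
`F` represents `f ∘ φ`, then `H ∘ F` represents `(G ∘ f) ∘ φ`. -/
lemma Surface.Represents.comp {S : Surface M} {φ : ℂ⟦X⟧} (hφ : PowerSeries.constantCoeff φ = 0)
    {f : ℤ⟦X⟧} (hf : PowerSeries.constantCoeff f = 0) {F : M → ℂ} (hF : S.Represents φ f F)
    {D : Set ℂ} (hD : IsOpen D) (hFD : Set.MapsTo F S.V D) {H : ℂ → ℂ}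
    (hH : DifferentiableOn ℂ H D) {G : ℤ⟦X⟧}
    (hG : maclaurin H = PowerSeries.map (algebraMap ℤ ℂ) G) :
    S.Represents φ (PowerSeries.subst f G) fun x => H (F x) := by
  obtain ⟨⟨U, hU, hVU, hFU⟩, hT⟩ := hF
  have hOV : S.O ∈ S.V := interior_subset S.O_mem
  have sφ := PowerSeries.HasSubst.of_constantCoeff_zero' hφ
  have sf := PowerSeries.HasSubst.of_constantCoeff_zero' hf
  have hT0 : PowerSeries.constantCoeff (taylor S.z F) = 0 := by
    rw [hT]
    exact PowerSeries.constantCoeff_subst_eq_zero hφ f hf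
  have hF0 : F S.O = 0 := by
    refine Eq.trans ?_ hT0
    rw [show taylor S.z F = maclaurin (F ∘ S.z.symm) from rfl, constantCoeff_maclaurin]
    simp [S.coord.symm_zero]
  refine ⟨⟨U ∩ F ⁻¹' D, hFU.continuousOn.isOpen_inter_preimage hU hD,
    fun x hx => ⟨hVU hx, hFD hx⟩, ?_⟩, ?_⟩
  · exact (mdifferentiableOn_iff_differentiableOn.mpr hH).comp
      (hFU.mono Set.inter_subset_left) fun x hx => hx.2
  · have h0 : (0 : ℂ) ∈ D := hF0 ▸ hFD hOV
    rw [taylor_comp S.coord hU (hVU hOV) hFU hF0 (hH.analyticAt (hD.mem_nhds h0)), hG,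
      subst_map_algebraMap (PowerSeries.HasSubst.of_constantCoeff_zero' hT0), hT,
      PowerSeries.subst_comp_subst_apply sf sφ]

lemma mk_intPowerSeries_le : Cardinal.mk ℤ⟦X⟧ ≤ Cardinal.continuum := by
  have h : Function.Injective fun (f : ℤ⟦X⟧) (n : ℕ) => PowerSeries.coeff n f :=
    fun f g hfg => PowerSeries.ext fun n => congrFun hfg n
  refine (Cardinal.mk_le_of_injective h).trans ?_
  simp

end FormalAnalytic

theorem theorem1p1 {M : Type*} [TopologicalSpace M] [T2Space M] [ConnectedSpace M]
    [ChartedSpace ℂ M] [IsManifold 𝓘(ℂ) ω M]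
    (S : FormalAnalytic.Surface M) (hS : S.Pseudoconvex)
    (φ : ℂ⟦X⟧) (hφ : FormalAnalytic.IsCompositionalInverse S.glue φ)
    (f : ℤ⟦X⟧) (hf : FormalAnalytic.IsNonconstantMonic f)
    (ϕ : M → ℂ) (hϕ : S.Represents φ f ϕ)
    (hconj : FormalAnalytic.ConjectureHoldsFor S.V S.O S.z ϕ) :
    Cardinal.mk {g : ℤ⟦X⟧ // ∃ G : M → ℂ, S.Represents φ g G} = Cardinal.continuum := by
  open FormalAnalytic in
  obtain ⟨e, he, hf0, hf1⟩ := hf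
  have hfc : PowerSeries.constantCoeff f = 0 := by
    simpa using hf0 0 he
  have hfne : f ≠ 0 := by
    rintro rfl
    simp at hf1
  obtain ⟨hlow, htop⟩ := coeff_subst_of_monic hφ.zero hf0 hf1
  rw [← hϕ.2] at hlow htop
  have hinv := hφ.coeff_one_mul S.glue_zero
  have hφ1 : PowerSeries.coeff 1 φ ≠ 0 := left_ne_zero_of_mul_eq_one hinv
  have htop0 : PowerSeries.coeff e (taylor S.z ϕ) ≠ 0 := htop ▸ pow_ne_zero e hφ1
  have horder : (taylor S.z ϕ).order = e := PowerSeries.order_eq_nat.mpr ⟨htop0, hlow⟩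
  have hcap := capacity_pos S.V S.O S.z
  have hjet : Real.log (capJetNorm S.V S.O S.z e ϕ) < 0 := by
    have h1 : capJetNorm S.V S.O S.z e ϕ =
        ((‖PowerSeries.coeff 1 S.glue‖ * capacity S.V S.O S.z)⁻¹) ^ e := by
      rw [capJetNorm, htop, capTangentNorm, norm_one, one_mul, norm_pow, ← mul_pow, mul_inv,
        eq_inv_of_mul_eq_one_left hinv, norm_inv]
    have h2 := hS.one_lt
    rw [h1]
    exact Real.log_neg (pow_pos (inv_pos.mpr (zero_lt_one.trans h2)) e)
      (pow_lt_one₀ (inv_nonneg.mpr (zero_lt_one.trans h2).le) (inv_lt_one_of_one_lt₀ h2)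
        (by lia))
  obtain ⟨p, hp, c, hc, hpV⟩ := hconj e S.σ hϕ.1 horder S.real hjet
    (hϕ.eventually_apply_involution hφ)
  have hd : 1 ≤ p.natDegree := by
    by_contra hd
    have hp1 : p = 1 := Polynomial.eq_one_of_monic_natDegree_zero hp (by lia)
    -- A constant `p` would force `ϕ` to vanish on `V`.
    have hzero : ∀ x ∈ S.V, ϕ x = 0 := by
      intro x hx
      by_contra hx0
      have := hpV x hx hx0
      simp only [hp1, map_one, norm_one] at this
      exact absurd hc this.not_gt
    refine htop0 ?_
    have hsymm : ContinuousAt S.z.symm 0 := by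
      rw [← S.coord.map_zero]
      exact S.z.continuousAt_symm (S.z.map_source S.coord.mem_source)
    have hnhds : S.V ∈ 𝓝 (S.z.symm 0) := by
      rw [S.coord.symm_zero]; exact mem_interior_iff_mem_nhds.mp S.O_mem
    have hev : ϕ ∘ S.z.symm =ᶠ[𝓝 0] fun _ => 0 := by
      filter_upwards [hsymm.preimage_mem_nhds hnhds] with w hw
      exact hzero _ hw
    rw [show taylor S.z ϕ = maclaurin (ϕ ∘ S.z.symm) from rfl, maclaurin_congr hev,
      maclaurin_const, map_zero, map_zero]
  have hq : p.reverse.coeff 0 = 1 := by rw [Polynomial.coeff_zero_reverse, hp.leadingCoeff]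
  have hmaps : Set.MapsTo ϕ S.V (lemniscate p.reverse p.natDegree) := by
    intro x hx
    by_cases hx0 : ϕ x = 0
    · rw [hx0]; exact zero_mem_lemniscate hq hd
    · exact mem_lemniscate_reverse hx0 (hc.trans_le (hpV x hx hx0))
  obtain ⟨G, hGinj, hG⟩ := exists_injective_integral_maclaurin hq hd
  refine le_antisymm ((Cardinal.mk_subtype_le _).trans mk_intPowerSeries_le) ?_
  have hrep : ∀ ε, ∃ F : M → ℂ, S.Represents φ (PowerSeries.subst f (G ε)) F := by
    intro ε
    obtain ⟨H, hH, hHG⟩ := hG ε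
    exact ⟨_, hϕ.comp hφ.zero hfc (isOpen_lemniscate _ _) hmaps hH hHG⟩
  have hinj : Function.Injective fun ε : ℕ → Bool =>
      (⟨PowerSeries.subst f (G ε), hrep ε⟩ :
        {g : ℤ⟦X⟧ // ∃ F : M → ℂ, S.Represents φ g F}) :=
    fun ε ε' h => hGinj (subst_injective hfc hfne (congrArg Subtype.val h))
  have hcard : Cardinal.continuum = Cardinal.lift.{_, 0} (Cardinal.mk (ℕ → Bool)) := by simp
  rw [hcard]
  simpa using Cardinal.mk_le_of_injective hinj
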